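/- **Setting.** For groups $G,H$, a bimodule $M\colon G\nrightarrow H$ is a set with a left $H$-action and a right $G$-action such that $(h\cdot m)\cdot g=h\cdot(m\cdot g)$; maps of bimodules are maps of sets that commute with both actions. It is an *atlas bimodule* if it is non-empty, the left $H$-action is free and transitive, and the right $G$-action is free. The composite of $M\colon G\nrightarrow H$ and $N\colon H\nrightarrow K$ is $N\otimes_H M=(N\times M)/\bigl((y\cdot h,x)\sim(y,h\cdot x)\bigr)$, the identity of $G$ is the set $G$ with left and right multiplication, and a homomorphism $\phi\colon G\to H$ gives the bimodule $\pmb\phi\colon G\nrightarrow H$ with underlying set $H$, on which $H$ acts by left multiplication and $h\cdot g=h\phi(g)$. An *orbifold chart* of dimension $n$ for a space $U$ is a quadruple $(\widetilde U,G,\rho,\pi)$ consisting of a connected and simply connected open set $\widetilde U\subseteq\mathbb R^n$, a finite group $G$, a (not necessarily faithful) homomorphism $\rho$ from $G$ to the group of smooth automorphisms of $\widetilde U$, with image $G^{\mathrm{red}}=\rho(G)$, and a continuous surjection $\pi\colon\widetilde U\to U$ that induces a homeomorphism $\widetilde U/G^{\mathrm{red}}\cong U$. Let $X$ be a paracompact,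 second countable, Hausdorff space. An *orbifold atlas* $\mathfrak U$ of dimension $n$ for $X$ consists of the following. 1. A family $\mathcal U=\{(\widetilde U_i,G_i,\rho_i,\pi_i)\}_{i\in I}$ of orbifold charts of dimension $n$ for open subsets $U_i\subseteq X$. Let $\mathcal O(\mathcal U)$ be the category with the charts as objects and one arrow $\mu_{ji}\colon U_i\to U_j$ whenever $U_i\subseteq U_j$ (then we write $U_i\le U_j$), and let $\mathsf{Con}(\mu_{ji})$ be the set of smooth embeddings $\lambda\colon\widetilde U_i\to\widetilde U_j$ with $\pi_i=\pi_j\circ\lambda$ (*concrete embeddings*). The $U_i$ cover $X$, and for all $i,j\in I$ and $x\in U_i\cap U_j$ there is $k\in I$ with $x\in U_k\subseteq U_i\cap U_j$ such that there are concrete embeddings of $\widetilde U_k$ into $\widetilde U_i$ and into $\widetilde U_j$. Composition makes $\mathsf{Con}(\mu_{ji})$ a bimodule $G_i^{\mathrm{red}}\nrightarrow G_j^{\mathrm{red}}$; put $\gamma_{kji}(\lambda'\otimes\lambda)=\lambda'\circ\lambda$, and let $\gamma_i\colon G_i^{\mathrm{red}}\to\mathsf{Con}(\mu_{ii})$ be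 the inclusion. 2. A pseudofunctor $\mathsf{Abst}$ from $\mathcal O(\mathcal U)$ to the bicategory of groups and bimodules with $\mathsf{Abst}(U_i)=G_i$ such that each $\mathsf{Abst}(\mu_{ji})\colon G_i\nrightarrow G_j$ is an atlas bimodule; its elements are the *abstract embeddings*. Its composition isomorphisms are denoted $\alpha_{kji}\colon\mathsf{Abst}(\mu_{kj})\otimes_{G_j}\mathsf{Abst}(\mu_{ji})\Rightarrow\mathsf{Abst}(\mu_{ki})$. 3. An oplax transformation $\pmb\rho\colon\mathsf{Abst}\Rightarrow\mathsf{Con}$ whose component at $U_i$ is the bimodule $\pmb\rho_i\colon G_i\nrightarrow G_i^{\mathrm{red}}$ given by $\rho_i$, that is, bimodule maps $\rho_{ji}\colon\pmb\rho_j\otimes_{G_j}\mathsf{Abst}(\mu_{ji})\Rightarrow\mathsf{Con}(\mu_{ji})\otimes_{G_i^{\mathrm{red}}}\pmb\rho_i$ compatible with the composition and unit cells of $\mathsf{Abst}$ and of $\mathsf{Con}$. Every $\rho_{ji}$ is surjective, and whenever $\rho_{ji}(e\otimes\lambda)=\rho_{ji}(e\otimes\lambda')$ there is $g\in G_i$ with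 $\lambda\cdot g=\lambda'$. Every $\lambda\in\mathsf{Abst}(\mu_{ji})$ has an underlying concrete embedding $\widetilde\lambda\colon\widetilde U_i\to\widetilde U_j$, the unique element of $\mathsf{Con}(\mu_{ji})$ such that $\rho_{ji}(e\otimes\lambda)=\widetilde\lambda\otimes e$. **Lemma.** Let $\mathfrak U$ be an orbifold atlas. For any charts $\widetilde U_1,\widetilde U_2,\widetilde U_3$ with $U_1\le U_3$ and $U_2\le U_3$ in $\mathcal O(\mathcal U)$, points $x_i\in\widetilde U_i$ for $i=1,2,3$, and abstract embeddings $\lambda_{3i}\in\mathsf{Abst}(\mu_{3i})$ such that $\widetilde\lambda_{3i}(x_i)=x_3$ for $i=1,2$, there are a chart $\widetilde U_4$ of the atlas with $U_4\le U_1$ and $U_4\le U_2$, a point $y\in\widetilde U_4$, and abstract embeddings $\kappa_{i4}\in\mathsf{Abst}(\mu_{i4})$ such that $\widetilde\kappa_{i4}(y)=x_i$ for $i=1,2$ and $$\alpha_{314}(\lambda_{31}\otimes\kappa_{14})=\alpha_{324}(\lambda_{32}\otimes\kappa_{24}).$$ -/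

import Mathlib

open scoped Manifold ContDiff
open MulOpposite Topology TopologicalSpace

/-! ### Group bimodules -/

/-- A bimodule `G ⇸ H` between two groups: a set with a left action of `H` and a right action of `G`
(an action of the opposite group) such that `(h • m) • g = h • (m • g)`. -/
structure GroupBimodule.{u, v, w} (G : Type u) (H : Type v) [Group G] [Group H] where
  /-- the underlying set -/
  carrier : Type w
  [leftAction : MulAction H carrier]
  [rightAction : MulAction Gᵐᵒᵖ carrier]
  [compatible : SMulCommClass H Gᵐᵒᵖ carrier]

namespace GroupBimodule

universe u v w x

instance (G : Type u) (H : Type v) [Group G] [Group H] :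
    CoeSort (GroupBimodule.{u, v, w} G H) (Type w) := ⟨GroupBimodule.carrier⟩

attribute [instance] GroupBimodule.leftAction GroupBimodule.rightAction GroupBimodule.compatible

section

variable {G : Type u} {H : Type v} [Group G] [Group H]

/-- Atlas bimodules: non-empty, with free and transitive left action and free right action. -/
structure IsAtlasBimodule (M : GroupBimodule.{u, v, w} G H) : Prop where
  nonempty : Nonempty M
  left_free : ∀ (h : H) (m : M), h • m = m → h = 1
  left_transitive : ∀ m m' : M, ∃ h : H, h • m = m'
  right_free : ∀ (g : G) (m : M), op g • m = m → g = 1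

/-- Maps of bimodules: maps of sets commuting with both actions. -/
structure Hom (M : GroupBimodule.{u, v, w} G H) (N : GroupBimodule.{u, v, x} G H) where
  /-- the underlying map of sets -/
  toFun : M → N
  map_left : ∀ (h : H) (m : M), toFun (h • m) = h • toFun m
  map_right : ∀ (g : G) (m : M), toFun (op g • m) = op g • toFun m

instance (M : GroupBimodule.{u, v, w} G H) (N : GroupBimodule.{u, v, x} G H) :
    CoeFun (Hom M N) (fun _ => M → N) := ⟨Hom.toFun⟩

/-- The bimodule `G ⇸ H` induced by a homomorphism `φ : G → H`: the set `H` with left multiplication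
by `H` and with `h · g = h * φ g`. -/
def ofHom (φ : G →* H) : GroupBimodule.{u, v, v} G H where
  carrier := H
  leftAction := inferInstanceAs (MulAction H H)
  rightAction :=
    { smul := fun g h => h * φ g.unop
      one_smul := fun h => by
        change h * φ 1 = h
        simp
      mul_smul := fun g g' h => by
        change h * φ (g'.unop * g.unop) = (h * φ g'.unop) * φ g.unop
        simp [mul_assoc] }
  compatible := @SMulCommClass.mk _ _ _ (_) (_) fun h g m => by
    change h * (m * φ g.unop) = (h * m) * φ g.unop
    simp [mul_assoc]

/-- The trivial bimodule `G ⇸ G`: the set `G` with left and right multiplication. -/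
abbrev trivial (G : Type u) [Group G] : GroupBimodule.{u, u, u} G G := ofHom (MonoidHom.id G)

end

section

variable {G H K : Type*} [Group G] [Group H] [Group K]

/-- The equivalence relation on `N × M` generated by `(y · h, x) ∼ (y, h · x)`; these identifications
already form an equivalence relation, as `H` is a group. -/
def tensorSetoid (N : GroupBimodule.{_, _, w} H K) (M : GroupBimodule.{_, _, x} G H) :
    Setoid (N × M) where
  r p q := ∃ h : H, q.1 = op h • p.1 ∧ p.2 = h • q.2
  iseqv :=
    { refl := fun p => ⟨1, by simp, by simp⟩
      symm := by
        rintro p q ⟨h, h1, h2⟩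
        refine ⟨h⁻¹, ?_, ?_⟩
        · rw [h1, smul_smul, ← op_mul, mul_inv_cancel, op_one, one_smul]
        · rw [h2, smul_smul, inv_mul_cancel, one_smul]
      trans := by
        rintro p q r ⟨h, h1, h2⟩ ⟨k, k1, k2⟩
        refine ⟨h * k, ?_, ?_⟩
        · rw [k1, h1, smul_smul, op_mul]
        · rw [h2, k2, smul_smul] }

/-- The composite of `M : G ⇸ H` and `N : H ⇸ K`, the tensor product `N ⊗_H M : G ⇸ K`. -/
def tensor (N : GroupBimodule.{_, _, w} H K) (M : GroupBimodule.{_, _, x} G H) :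
    GroupBimodule.{_, _, max w x} G K where
  carrier := Quotient (tensorSetoid N M)
  leftAction :=
    { smul := fun k => Quotient.map (fun p => (k • p.1, p.2)) (by
        rintro p q ⟨h, h1, h2⟩
        exact ⟨h, by simp only [h1, smul_comm], h2⟩)
      one_smul := by
        rintro ⟨p⟩
        change Quotient.mk _ ((1 : K) • p.1, p.2) = Quotient.mk _ p
        rw [one_smul]
      mul_smul := by
        rintro k k' ⟨p⟩
        change Quotient.mk _ ((k * k') • p.1, p.2) = Quotient.mk _ (k • k' • p.1, p.2)
        rw [mul_smul] }
  rightAction :=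
    { smul := fun g => Quotient.map (fun p => (p.1, g • p.2)) (by
        rintro p q ⟨h, h1, h2⟩
        exact ⟨h, h1, by simp only [h2, smul_comm]⟩)
      one_smul := by
        rintro ⟨p⟩
        change Quotient.mk _ (p.1, (1 : Gᵐᵒᵖ) • p.2) = Quotient.mk _ p
        rw [one_smul]
      mul_smul := by
        rintro k k' ⟨p⟩
        change Quotient.mk _ (p.1, (k * k') • p.2) = Quotient.mk _ (p.1, k • k' • p.2)
        rw [mul_smul] }
  compatible := @SMulCommClass.mk _ _ _ (_) (_) (by rintro k g ⟨p⟩; rfl)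

/-- The element `y ⊗ x` of `N ⊗_H M`. -/
def tmul {N : GroupBimodule.{_, _, w} H K} {M : GroupBimodule.{_, _, x} G H} (y : N) (x : M) :
    tensor N M :=
  Quotient.mk (tensorSetoid N M) (y, x)

theorem tmul_eq_tmul_iff {N : GroupBimodule.{_, _, w} H K} {M : GroupBimodule.{_, _, x} G H}
    {y y' : N} {x x' : M} :
    tmul y x = tmul y' x' ↔ ∃ h : H, y' = op h • y ∧ x = h • x' :=
  Quotient.eq (r := tensorSetoid N M)

theorem exists_tmul {N : GroupBimodule.{_, _, w} H K} {M : GroupBimodule.{_, _, x} G H}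
    (t : tensor N M) : ∃ (y : N) (x : M), tmul y x = t := by
  obtain ⟨p, rfl⟩ := Quotient.exists_rep t
  exact ⟨p.1, p.2, rfl⟩

/-- For `φ : G → H` and `N : H ⇸ K`, the canonical map `N ⊗_H ofHom φ → N`, `y ⊗ h ↦ y · h`.
It is inverse to `y ↦ y ⊗ 1`. -/
def contract (φ : G →* H) (N : GroupBimodule.{_, _, w} H K) : tensor N (ofHom φ) → N :=
  Quotient.lift (fun p : N × ofHom φ => op (show H from p.2) • p.1) (by
    rintro ⟨y, x⟩ ⟨y', x'⟩ ⟨h, h1, h2⟩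
    have h2' : (show H from x) = h * (show H from x') := h2
    dsimp only at h1 ⊢
    rw [h2', h1, op_mul, smul_smul])

theorem contract_tmul (φ : G →* H) (N : GroupBimodule.{_, _, w} H K) (y : N) (h : H) :
    contract φ N (tmul y (show ofHom φ from h)) = op h • y := rfl

theorem tmul_contract (φ : G →* H) (N : GroupBimodule.{_, _, w} H K) (t : tensor N (ofHom φ)) :
    tmul (contract φ N t) (show ofHom φ from (1 : H)) = t := by
  obtain ⟨y, x, rfl⟩ := exists_tmul t
  refine (tmul_eq_tmul_iff.2 ⟨(show H from x), rfl, ?_⟩).symm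
  change (show H from x) = (show H from x) * 1
  rw [mul_one]

end

end GroupBimodule

/-! ### Pseudofunctors into group bimodules and oplax transformations

`S : I → P` is a family of elements of a preorder. The set `I`, with exactly one arrow `i ⟶ j`
whenever `S i ≤ S j`, is a category. -/

open GroupBimodule in
/-- A lax functor from the category `I` (an arrow `i ⟶ j` iff `S i ≤ S j`) to the bicategory of groups
and bimodules with values `G i` on objects: bimodules `map hij : G i ⇸ G j`, composition cells
`comp hij hjk : map hjk ⊗ map hij ⇒ map hik`, and unit cells `unit i : G i ⇒ map hii`, subject to the
associativity and unit coherence laws. -/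
structure BimoduleLaxFunctor.{p, i, u, w} {P : Type p} [Preorder P] {I : Type i} (S : I → P)
    (G : I → Type u) [∀ i, Group (G i)] where
  map : ∀ {i j : I}, S i ≤ S j → GroupBimodule.{u, u, w} (G i) (G j)
  comp : ∀ {i j k : I} (hij : S i ≤ S j) (hjk : S j ≤ S k),
    Hom (tensor (map hjk) (map hij)) (map (hij.trans hjk))
  unit : ∀ i : I, Hom (GroupBimodule.trivial (G i)) (map (le_refl (S i)))
  assoc : ∀ {i j k l : I} (hij : S i ≤ S j) (hjk : S j ≤ S k) (hkl : S k ≤ S l)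
    (a : map hkl) (b : map hjk) (c : map hij),
    comp hij (hjk.trans hkl) (tmul (comp hjk hkl (tmul a b)) c) =
      comp (hij.trans hjk) hkl (tmul a (comp hij hjk (tmul b c)))
  unit_left : ∀ {i j : I} (hij : S i ≤ S j) (g : G j) (a : map hij),
    comp hij (le_refl (S j)) (tmul (unit j g) a) = g • a
  unit_right : ∀ {i j : I} (hij : S i ≤ S j) (a : map hij) (g : G i),
    comp (le_refl (S i)) hij (tmul a (unit i g)) = op g • a

/-- A lax functor is a pseudofunctor if its composition and unit cells are isomorphisms. -/
structure BimoduleLaxFunctor.IsPseudofunctor.{p, i, u, w} {P : Type p} [Preorder P] {I : Type i}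
    {S : I → P} {G : I → Type u} [∀ i, Group (G i)] (F : BimoduleLaxFunctor.{p, i, u, w} S G) :
    Prop where
  comp_bijective : ∀ {i j k : I} (hij : S i ≤ S j) (hjk : S j ≤ S k),
    Function.Bijective (F.comp hij hjk).toFun
  unit_bijective : ∀ i : I, Function.Bijective (F.unit i).toFun

open GroupBimodule in
/-- An oplax transformation `F ⇒ K` whose component at `i` is the bimodule `ofHom (φ i)` of a
homomorphism `φ i : G i → H i`: for each arrow `i ⟶ j` a map of bimodules
`app hij : ofHom (φ j) ⊗ F.map hij ⇒ K.map hij ⊗ ofHom (φ i)`, compatible with the structure cells of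
`F` and `K`. As every element of a tensor product has the form `y ⊗ x`, `app_comp` is the equality of
the two pastings, `app hik ∘ (id ⊗ F.comp)` and
`(K.comp ⊗ id) ∘ (id ⊗ app hij) ∘ (app hjk ⊗ id)`, evaluated at `r ⊗ a ⊗ b`; `app_unit` is the equality
`app hii ∘ (id ⊗ F.unit i) = (K.unit i ⊗ id) ∘ φ̂ i` with `φ̂ i (r ⊗ g) = r * φ i g ⊗ 1`. -/
structure BimoduleOplaxTrans.{p, i, u, v, w, x} {P : Type p} [Preorder P] {I : Type i} {S : I → P}
    {G : I → Type u} [∀ i, Group (G i)] {H : I → Type v} [∀ i, Group (H i)]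
    (φ : ∀ i, G i →* H i)
    (F : BimoduleLaxFunctor.{p, i, u, w} S G) (K : BimoduleLaxFunctor.{p, i, v, x} S H) where
  app : ∀ {i j : I} (hij : S i ≤ S j),
    Hom (tensor (ofHom (φ j)) (F.map hij)) (tensor (K.map hij) (ofHom (φ i)))
  app_comp : ∀ {i j k : I} (hij : S i ≤ S j) (hjk : S j ≤ S k)
    (r : ofHom (φ k)) (a : F.map hjk) (b : F.map hij)
    (c : K.map hjk) (s : ofHom (φ j)) (d : K.map hij) (t : ofHom (φ i)),
    app hjk (tmul r a) = tmul c s → app hij (tmul s b) = tmul d t →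
      app (hij.trans hjk) (tmul r (F.comp hij hjk (tmul a b))) = tmul (K.comp hij hjk (tmul c d)) t
  app_unit : ∀ (i : I) (r : H i) (g : G i),
    app (le_refl (S i)) (tmul (show ofHom (φ i) from r) (F.unit i g)) =
      tmul (K.unit i (r * φ i g)) (show ofHom (φ i) from (1 : H i))

/-- The map `a ↦ ã` underlying an oplax transformation: `ã` is the unique element with
`app hij (1 ⊗ a) = ã ⊗ 1` (see `tilde_unique`). -/
def BimoduleOplaxTrans.tilde {P : Type*} [Preorder P] {I : Type*} {S : I → P}
    {G : I → Type*} [∀ i, Group (G i)] {H : I → Type*} [∀ i, Group (H i)] {φ : ∀ i, G i →* H i}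
    {F : BimoduleLaxFunctor S G} {K : BimoduleLaxFunctor S H} (τ : BimoduleOplaxTrans φ F K)
    {i j : I} (hij : S i ≤ S j) (a : F.map hij) : K.map hij :=
  GroupBimodule.contract (φ i) (K.map hij)
    (τ.app hij (GroupBimodule.tmul (show GroupBimodule.ofHom (φ j) from (1 : H j)) a))

theorem BimoduleOplaxTrans.tilde_unique {P : Type*} [Preorder P] {I : Type*} {S : I → P}
    {G : I → Type*} [∀ i, Group (G i)] {H : I → Type*} [∀ i, Group (H i)] {φ : ∀ i, G i →* H i}
    {F : BimoduleLaxFunctor S G} {K : BimoduleLaxFunctor S H} (τ : BimoduleOplaxTrans φ F K)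
    {i j : I} (hij : S i ≤ S j) (a : F.map hij) (c : K.map hij) :
    τ.app hij (GroupBimodule.tmul (show GroupBimodule.ofHom (φ j) from (1 : H j)) a) =
      GroupBimodule.tmul c (show GroupBimodule.ofHom (φ i) from (1 : H i)) ↔
    c = τ.tilde hij a := by
  constructor
  · intro h
    rw [BimoduleOplaxTrans.tilde, h, GroupBimodule.contract_tmul, op_one, one_smul]
  · rintro rfl
    exact (GroupBimodule.tmul_contract _ _ _).symm

/-! ### Orbifold charts and concrete embeddings -/

/-- A smooth embedding between open subsets of `ℝⁿ`: a smooth map with injective differential at each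
point which is a homeomorphism onto its image. -/
structure IsSmoothEmb {n : ℕ} {V W : Opens (EuclideanSpace ℝ (Fin n))} (f : V → W) : Prop where
  contMDiff : ContMDiff (𝓡 n) (𝓡 n) ∞ f
  mfderiv_injective : ∀ x, Function.Injective (mfderiv (𝓡 n) (𝓡 n) f x)
  isEmbedding : IsEmbedding f

theorem IsSmoothEmb.comp {n : ℕ} {V W Z : Opens (EuclideanSpace ℝ (Fin n))} {g : W → Z} {f : V → W}
    (hg : IsSmoothEmb g) (hf : IsSmoothEmb f) : IsSmoothEmb (g ∘ f) where
  contMDiff := hg.contMDiff.comp hf.contMDiff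
  mfderiv_injective x := by
    rw [mfderiv_comp x (hg.contMDiff.mdifferentiable (by simp) _)
      (hf.contMDiff.mdifferentiable (by simp) _)]
    exact (hg.mfderiv_injective _).comp (hf.mfderiv_injective _)
  isEmbedding := hg.isEmbedding.comp hf.isEmbedding

theorem IsSmoothEmb.of_perm {n : ℕ} {V : Opens (EuclideanSpace ℝ (Fin n))} (σ : Equiv.Perm V)
    (h : ContMDiff (𝓡 n) (𝓡 n) ∞ σ) (h' : ContMDiff (𝓡 n) (𝓡 n) ∞ σ.symm) :
    IsSmoothEmb (σ : V → V) where
  contMDiff := h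
  mfderiv_injective x := by
    have key := mfderiv_comp x (h'.mdifferentiable (by simp) (σ x)) (h.mdifferentiable (by simp) x)
    rw [show (σ.symm : V → V) ∘ σ = id from funext fun y => σ.symm_apply_apply y, mfderiv_id] at key
    intro a b hab
    have ha := congrArg (fun L => L a) key
    have hb := congrArg (fun L => L b) key
    have ha' : a = mfderiv (𝓡 n) (𝓡 n) σ.symm (σ x) (mfderiv (𝓡 n) (𝓡 n) σ x a) := ha
    have hb' : b = mfderiv (𝓡 n) (𝓡 n) σ.symm (σ x) (mfderiv (𝓡 n) (𝓡 n) σ x b) := hb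
    rw [ha', hb', hab]
  isEmbedding := (Homeomorph.mk σ h.continuous h'.continuous).isEmbedding

/-- An orbifold chart of dimension `n` for the space `U`: a simply connected (in particular non-empty
and connected) open subset `dom` of `ℝⁿ`, a finite group `G` acting on it, not necessarily faithfully,
by smooth automorphisms (each `ρ g` is smooth, and so is its inverse `ρ g⁻¹`), and a continuous
surjective map `π : dom → U` that induces a homeomorphism from the orbit space onto `U`, i.e. a
quotient map whose fibres are the orbits. -/
structure OrbifoldChart.{u, v} (n : ℕ) (U : Type u) [TopologicalSpace U] where
  dom : Opens (EuclideanSpace ℝ (Fin n))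
  simplyConnected : SimplyConnectedSpace dom
  G : Type v
  [group : Group G]
  [finite : Finite G]
  ρ : G →* Equiv.Perm dom
  smooth_ρ : ∀ g, ContMDiff (𝓡 n) (𝓡 n) ∞ (ρ g : dom → dom)
  π : dom → U
  isQuotientMap_π : IsQuotientMap π
  π_eq_iff : ∀ x y, π x = π y ↔ ∃ g, ρ g x = y

attribute [instance] OrbifoldChart.group OrbifoldChart.finite

/-- The reduced group `ρ(G)`, a group of automorphisms of the domain of the chart. -/
abbrev OrbifoldChart.Gred {n : ℕ} {U : Type*} [TopologicalSpace U] (c : OrbifoldChart n U) :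
    Subgroup (Equiv.Perm c.dom) := c.ρ.range

theorem OrbifoldChart.isSmoothEmb_of_mem {n : ℕ} {U : Type*} [TopologicalSpace U]
    (c : OrbifoldChart n U) (σ : c.Gred) : IsSmoothEmb (σ.1 : c.dom → c.dom) := by
  obtain ⟨_, g, rfl⟩ := σ
  refine IsSmoothEmb.of_perm _ (c.smooth_ρ g) ?_
  have := c.smooth_ρ g⁻¹
  rwa [map_inv] at this

theorem OrbifoldChart.π_of_mem {n : ℕ} {U : Type*} [TopologicalSpace U]
    (c : OrbifoldChart n U) (σ : c.Gred) (x : c.dom) : c.π (σ.1 x) = c.π x := by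
  obtain ⟨_, g, rfl⟩ := σ
  exact ((c.π_eq_iff _ _).2 ⟨g, rfl⟩).symm

/-- A family of orbifold charts of dimension `n`, each for an open subset of the space `X`. -/
structure ChartFamily.{u, v, i} (n : ℕ) (X : Type u) [TopologicalSpace X] (I : Type i) where
  U : I → Opens X
  chart : ∀ i, OrbifoldChart.{u, v} n (U i)

namespace ChartFamily

variable {n : ℕ} {X : Type*} [TopologicalSpace X] {I : Type*}

/-- The domain `Ũ_i` of the `i`-th chart. -/
abbrev dom (𝒰 : ChartFamily n X I) (i : I) : Opens (EuclideanSpace ℝ (Fin n)) := (𝒰.chart i).dom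

/-- The structure group `G_i` of the `i`-th chart. -/
abbrev G (𝒰 : ChartFamily n X I) (i : I) : Type _ := (𝒰.chart i).G

/-- The reduced group `G_i^red` of the `i`-th chart. -/
abbrev Gred (𝒰 : ChartFamily n X I) (i : I) : Type _ := (𝒰.chart i).Gred

/-- The group homomorphism `ρ_i : G_i → G_i^red`. -/
abbrev ρ (𝒰 : ChartFamily n X I) (i : I) : 𝒰.G i →* 𝒰.Gred i := (𝒰.chart i).ρ.rangeRestrict

/-- The concrete embeddings from the `i`-th to the `j`-th chart: smooth embeddings
`lam : Ũ_i → Ũ_j` with `π_i = π_j ∘ lam`. -/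
def ConcreteEmbedding (𝒰 : ChartFamily n X I) (i j : I) : Type :=
  {lam : 𝒰.dom i → 𝒰.dom j //
    IsSmoothEmb lam ∧ ∀ x, ((𝒰.chart i).π x : X) = ((𝒰.chart j).π (lam x) : X)}

/-- Composition of concrete embeddings. -/
def ConcreteEmbedding.comp {𝒰 : ChartFamily n X I} {i j k : I} (b : 𝒰.ConcreteEmbedding j k)
    (a : 𝒰.ConcreteEmbedding i j) : 𝒰.ConcreteEmbedding i k :=
  ⟨b.1 ∘ a.1, b.2.1.comp a.2.1, fun x => (a.2.2 x).trans (b.2.2 (a.1 x))⟩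

/-- The elements of `G_i^red`, regarded as concrete embeddings of the `i`-th chart into itself. -/
def ConcreteEmbedding.ofGred (𝒰 : ChartFamily n X I) (i : I) (σ : 𝒰.Gred i) :
    𝒰.ConcreteEmbedding i i :=
  ⟨σ.1, (𝒰.chart i).isSmoothEmb_of_mem σ,
    fun x => congrArg Subtype.val ((𝒰.chart i).π_of_mem σ x).symm⟩

/-- The bimodule `G_i^red ⇸ G_j^red` of concrete embeddings; both actions are given by composition. -/
def conBimodule (𝒰 : ChartFamily n X I) (i j : I) : GroupBimodule (𝒰.Gred i) (𝒰.Gred j) where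
  carrier := 𝒰.ConcreteEmbedding i j
  leftAction :=
    { smul := fun σ a => (ConcreteEmbedding.ofGred 𝒰 j σ).comp a
      one_smul := fun _ => rfl
      mul_smul := fun _ _ _ => rfl }
  rightAction :=
    { smul := fun σ a => a.comp (ConcreteEmbedding.ofGred 𝒰 i σ.unop)
      one_smul := fun _ => rfl
      mul_smul := fun _ _ _ => rfl }
  compatible := @SMulCommClass.mk _ _ _ (_) (_) fun _ _ _ => rfl

/-- `Con`, with the bimodules of concrete embeddings as values, with the maps
`b ⊗ a ↦ b ∘ a` as composition cells and with the inclusions of the groups `G_i^red` as unit cells.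
(It is a theorem that these cells are isomorphisms; the definition of an atlas does not need it.) -/
def Con (𝒰 : ChartFamily n X I) : BimoduleLaxFunctor 𝒰.U 𝒰.Gred where
  map {i j} _ := 𝒰.conBimodule i j
  comp {i j k} _ _ :=
    { toFun := Quotient.lift
        (fun p : 𝒰.ConcreteEmbedding j k × 𝒰.ConcreteEmbedding i j => p.1.comp p.2) (by
          rintro ⟨b, a⟩ ⟨b', a'⟩ ⟨σ, h1, h2⟩
          dsimp only at h1 h2 ⊢
          rw [h1, h2]
          rfl)
      map_left := by rintro σ ⟨p⟩; rfl
      map_right := by rintro σ ⟨p⟩; rfl }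
  unit i :=
    { toFun := fun σ => ConcreteEmbedding.ofGred 𝒰 i σ
      map_left := fun _ _ => rfl
      map_right := fun _ _ => rfl }
  assoc _ _ _ _ _ _ := rfl
  unit_left _ _ _ := rfl
  unit_right _ _ _ := rfl

/-- The reduced charts form a Satake atlas for `X`: the sets `U_i` cover `X`, and every point `x` of
`U_i ∩ U_j` lies in some `U_k ⊆ U_i ∩ U_j` whose chart has concrete embeddings into the `i`-th and into
the `j`-th chart. -/
structure IsSatakeAtlas (𝒰 : ChartFamily n X I) : Prop where
  cover : ∀ x : X, ∃ i, x ∈ 𝒰.U i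
  locally_compatible : ∀ (i j : I) (x : X), x ∈ 𝒰.U i → x ∈ 𝒰.U j →
    ∃ k, x ∈ 𝒰.U k ∧ 𝒰.U k ≤ 𝒰.U i ∧ 𝒰.U k ≤ 𝒰.U j ∧
      Nonempty (𝒰.ConcreteEmbedding k i) ∧ Nonempty (𝒰.ConcreteEmbedding k j)

end ChartFamily

/-! ### Orbifold atlases -/

open GroupBimodule in
/-- An orbifold atlas of dimension `n` for `X`: a family of orbifold charts whose reduced charts form a
Satake atlas, a pseudofunctor `Abst` with values `G_i` on objects and with atlas bimodules (of *abstract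
embeddings*) as values on arrows, and an oplax transformation `ρρ : Abst ⇒ Con` whose components are
the bimodules induced by the `ρ_i : G_i → G_i^red`, which is surjective and transitive on the kernel. -/
structure OrbifoldAtlas.{u, v, i, w} (n : ℕ) (X : Type u) [TopologicalSpace X] (I : Type i)
    extends ChartFamily.{u, v, i} n X I where
  isSatakeAtlas : toChartFamily.IsSatakeAtlas
  Abst : BimoduleLaxFunctor.{u, i, v, w} toChartFamily.U toChartFamily.G
  isPseudofunctor : Abst.IsPseudofunctor
  isAtlasBimodule : ∀ {i j : I} (hij : toChartFamily.U i ≤ toChartFamily.U j),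
    (Abst.map hij).IsAtlasBimodule
  ρρ : BimoduleOplaxTrans toChartFamily.ρ Abst toChartFamily.Con
  surjective : ∀ {i j : I} (hij : toChartFamily.U i ≤ toChartFamily.U j),
    Function.Surjective (ρρ.app hij).toFun
  transitive_on_kernel : ∀ {i j : I} (hij : toChartFamily.U i ≤ toChartFamily.U j)
    (a a' : Abst.map hij),
    ρρ.app hij (tmul (show ofHom (toChartFamily.ρ j) from (1 : toChartFamily.Gred j)) a) =
      ρρ.app hij (tmul (show ofHom (toChartFamily.ρ j) from (1 : toChartFamily.Gred j)) a') →
    ∃ g : toChartFamily.G i, op g • a = a'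

namespace OrbifoldAtlas

variable {n : ℕ} {X : Type*} [TopologicalSpace X] {I : Type*}

/-- The concrete map `Ũ_i → Ũ_j` of an abstract embedding `a`: the concrete embedding `ã` determined
by `ρρ_ji (1 ⊗ a) = ã ⊗ 1`. -/
def concrete (𝔘 : OrbifoldAtlas n X I) {i j : I} {hij : 𝔘.U i ≤ 𝔘.U j} (a : 𝔘.Abst.map hij) :
    𝔘.dom i → 𝔘.dom j :=
  (show 𝔘.ConcreteEmbedding i j from 𝔘.ρρ.tilde hij a).1

/-- The composite `α_kji (b ⊗ a)` of abstract embeddings. -/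
def comp (𝔘 : OrbifoldAtlas n X I) {i j k : I} {hij : 𝔘.U i ≤ 𝔘.U j} {hjk : 𝔘.U j ≤ 𝔘.U k}
    (b : 𝔘.Abst.map hjk) (a : 𝔘.Abst.map hij) : 𝔘.Abst.map (hij.trans hjk) :=
  𝔘.Abst.comp hij hjk (GroupBimodule.tmul b a)

end OrbifoldAtlas

/-! Over a small chart `i₄` around the common image of `x₁` and `x₂`, abstract embeddings `a` and
`b` can be chosen that send a point `y` to `x₁` and `x₂`. The composites of `lam₃₁` with `a` and of
`lam₃₂` with `b` differ by some `g` in `G₃`, because the left action on an atlas bimodule is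
transitive. Evaluation at `y` shows that `lam₃₁` and `g • lam₃₁` both send `x₁` to `x₃`. If `g •
lam₃₁ = lam₃₁ · h` with `h` in `G₁`, then `h` can be absorbed into `a`.

Such an `h` exists by `exists_op_smul_eq_smul`. The image of a concrete embedding is open by the
inverse function theorem, and closed over `U_i` because chart projections are proper. As chart
domains are connected, two embeddings with meeting images satisfy `b = a ∘ σ` (`range_subset`,
`exists_comp_eq`). The self-embedding `σ` comes from the group (`exists_ofGred_eq`), and
transitivity on the kernel lifts the equality from concrete to abstract embeddings. -/

/-! ### Smooth embeddings between open subsets of `ℝⁿ`. -/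

theorem mfderiv_opens_val_bijective {n : ℕ} (V : Opens (EuclideanSpace ℝ (Fin n))) (x : V) :
    Function.Bijective (mfderiv (𝓡 n) (𝓡 n) (Subtype.val : V → EuclideanSpace ℝ (Fin n)) x) := by
  classical
  -- A left inverse of the inclusion, smooth at points of `V`; its value off `V` is irrelevant.
  let r : EuclideanSpace ℝ (Fin n) → V := fun e => if h : e ∈ V then ⟨e, h⟩ else x
  have hr : r ∘ Subtype.val = id := by
    funext z
    simp [r]
  have hrs : ContMDiffAt (𝓡 n) (𝓡 n) ∞ r x.1 := by
    rw [← contMDiffAt_subtype_iff]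
    change ContMDiffAt (𝓡 n) (𝓡 n) ∞ (r ∘ Subtype.val) x
    rw [hr]
    exact contMDiffAt_id
  have key := mfderiv_comp x (hrs.mdifferentiableAt (by simp))
    ((contMDiff_subtype_val (n := ∞)).mdifferentiable (by simp) x)
  rw [hr, mfderiv_id] at key
  have hinj : Function.Injective
      (mfderiv (𝓡 n) (𝓡 n) (Subtype.val : V → EuclideanSpace ℝ (Fin n)) x) :=
    Function.LeftInverse.injective fun v => (congrArg (fun L => L v) key).symm
  let D : EuclideanSpace ℝ (Fin n) →L[ℝ] EuclideanSpace ℝ (Fin n) :=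
    mfderiv (𝓡 n) (𝓡 n) (Subtype.val : V → EuclideanSpace ℝ (Fin n)) x
  exact ⟨hinj, (LinearMap.injective_iff_surjective (f := D.toLinearMap)).1 hinj⟩

/-- The inverse function theorem for smooth embeddings between open subsets of `ℝⁿ`. -/
theorem IsSmoothEmb.exists_localInverse {n : ℕ} {V W : Opens (EuclideanSpace ℝ (Fin n))}
    {f : V → W} (hf : IsSmoothEmb f) (x : V) :
    (∃ g : EuclideanSpace ℝ (Fin n) → EuclideanSpace ℝ (Fin n),
      ContDiffAt ℝ ∞ g (f x) ∧ ∀ᶠ z in 𝓝 x, g (f z) = z) ∧ 𝓝 (f x) ≤ (𝓝 x).map f := by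
  classical
  -- Extension by zero, so that the inverse function theorem on `ℝⁿ` applies; only the germ at `x`
  -- matters.
  let F : EuclideanSpace ℝ (Fin n) → EuclideanSpace ℝ (Fin n) :=
    fun e => if h : e ∈ V then f ⟨e, h⟩ else 0
  have hF : F ∘ Subtype.val = Subtype.val ∘ f := by
    funext z
    simp [F]
  have hFs : ContMDiffAt (𝓡 n) (𝓡 n) ∞ F x.1 := by
    rw [← contMDiffAt_subtype_iff]
    change ContMDiffAt (𝓡 n) (𝓡 n) ∞ (F ∘ Subtype.val) x
    rw [hF]
    exact contMDiff_subtype_val.contMDiffAt.comp x hf.contMDiff.contMDiffAt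
  have hFd : ContDiffAt ℝ ∞ F x := hFs.contDiffAt
  have hval (Z : Opens (EuclideanSpace ℝ (Fin n))) (z : Z) :
      MDifferentiableAt (𝓡 n) (𝓡 n) (Subtype.val : Z → EuclideanSpace ℝ (Fin n)) z :=
    (contMDiff_subtype_val (n := ∞)).mdifferentiable (by simp) z
  have key := mfderiv_comp x (hFs.mdifferentiableAt (by simp)) (hval V x)
  rw [hF, mfderiv_comp x (hval W (f x)) (hf.contMDiff.mdifferentiable (by simp) x),
    mfderiv_eq_fderiv] at key
  have hinj : Function.Injective (fderiv ℝ F x) := by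
    intro a b hab
    obtain ⟨a', rfl⟩ := (mfderiv_opens_val_bijective V x).2 a
    obtain ⟨b', rfl⟩ := (mfderiv_opens_val_bijective V x).2 b
    have h1 := congrArg (fun L => L a') key
    have h2 := congrArg (fun L => L b') key
    exact congrArg _ (hf.mfderiv_injective x
      ((mfderiv_opens_val_bijective W (f x)).1 (h1.trans (Eq.trans hab h2.symm))))
  let A : EuclideanSpace ℝ (Fin n) ≃L[ℝ] EuclideanSpace ℝ (Fin n) :=
    (LinearEquiv.ofInjectiveEndo (fderiv ℝ F x).toLinearMap hinj).toContinuousLinearEquiv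
  have hA : HasFDerivAt F (A : EuclideanSpace ℝ (Fin n) →L[ℝ] EuclideanSpace ℝ (Fin n)) x :=
    (hFd.differentiableAt (by simp)).hasFDerivAt
  have hS := hFd.hasStrictFDerivAt' hA (by simp)
  have hFx : F x = f x := congrFun hF x
  refine ⟨⟨hFd.localInverse hA (by simp), ?_, ?_⟩, ?_⟩
  · rw [← hFx]
    exact hFd.to_localInverse hA (by simp)
  · have := (continuous_subtype_val.continuousAt (x := x)).eventually hS.eventually_left_inverse
    filter_upwards [this] with z hz
    exact (congrArg _ (congrFun hF z)).symm.trans hz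
  · have h1 : Filter.map F (𝓝 x.1) = 𝓝 (f x).1 := by rw [hS.map_nhds_eq_of_equiv, hFx]
    have h2 : Filter.map Subtype.val (𝓝 x) = 𝓝 x.1 := V.isOpenEmbedding'.map_nhds_eq x
    have h3 : Filter.map Subtype.val (𝓝 (f x)) = 𝓝 (f x).1 := W.isOpenEmbedding'.map_nhds_eq _
    rw [← Filter.map_le_map_iff Subtype.val_injective, h3, Filter.map_map, ← hF, ← Filter.map_map,
      h2, h1]

theorem IsSmoothEmb.isOpenMap {n : ℕ} {V W : Opens (EuclideanSpace ℝ (Fin n))}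
    {f : V → W} (hf : IsSmoothEmb f) : IsOpenMap f :=
  IsOpenMap.of_nhds_le fun x => (hf.exists_localInverse x).2

/-- If a smooth embedding factors as a map followed by a smooth embedding between open subsets of
the same `ℝⁿ`, then the map is a smooth embedding. -/
theorem IsSmoothEmb.of_comp {n : ℕ} {V W Z : Opens (EuclideanSpace ℝ (Fin n))} {g : W → Z}
    {f : V → W} (hg : IsSmoothEmb g) (hgf : IsSmoothEmb (g ∘ f)) : IsSmoothEmb f := by
  have hc : Continuous f := hg.isEmbedding.continuous_iff.2 hgf.isEmbedding.continuous
  have hs : ContMDiff (𝓡 n) (𝓡 n) ∞ f := by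
    rw [← ContMDiff.subtypeVal_comp_iff]
    intro x
    -- Near `x`, the map `f` is `r ∘ (g ∘ f)`, with `r` a smooth local inverse of `g`.
    obtain ⟨⟨r, hr, hr'⟩, -⟩ := hg.exists_localInverse (f x)
    have h1 : ContMDiffAt (𝓡 n) (𝓡 n) ∞ (r ∘ (Subtype.val ∘ (g ∘ f))) x :=
      ContMDiffAt.comp x hr.contMDiffAt
        (contMDiff_subtype_val.contMDiffAt.comp x hgf.contMDiff.contMDiffAt)
    refine h1.congr_of_eventuallyEq ?_
    filter_upwards [hc.continuousAt.eventually hr'] with z hz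
    exact hz.symm
  refine ⟨hs, fun x => ?_, .of_comp hc hg.isEmbedding.continuous hgf.isEmbedding⟩
  have h := hgf.mfderiv_injective x
  rw [mfderiv_comp x (hg.contMDiff.mdifferentiable (by simp) _)
    (hs.mdifferentiable (by simp) _)] at h
  exact Function.Injective.of_comp (f := mfderiv (𝓡 n) (𝓡 n) g (f x)) h

/-! ### Properness of charts and images of concrete embeddings. -/

/-- Finiteness of the group is what counts: the saturation of a closed set is a finite union of
closed translates, and the fibres are finite orbits. -/
theorem OrbifoldChart.isProperMap_π {n : ℕ} {U : Type*} [TopologicalSpace U]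
    (c : OrbifoldChart n U) : IsProperMap c.π := by
  have hcont : ∀ g, Continuous (c.ρ g) := fun g => (c.smooth_ρ g).continuous
  refine isProperMap_iff_isClosedMap_and_compact_fibers.2
    ⟨c.isQuotientMap_π.continuous, fun C hC => ?_, fun u => ?_⟩
  · rw [← c.isQuotientMap_π.isClosed_preimage]
    have : c.π ⁻¹' (c.π '' C) = ⋃ g, c.ρ g ⁻¹' C := by
      ext x
      simp only [Set.mem_preimage, Set.mem_image, Set.mem_iUnion]
      constructor
      · rintro ⟨y, hy, h⟩
        obtain ⟨g, rfl⟩ := (c.π_eq_iff x y).1 h.symm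
        exact ⟨g, hy⟩
      · rintro ⟨g, hg⟩
        exact ⟨_, hg, ((c.π_eq_iff _ _).2 ⟨g, rfl⟩).symm⟩
    rw [this]
    exact isClosed_iUnion_of_finite fun g => hC.preimage (hcont g)
  · obtain ⟨x, rfl⟩ := c.isQuotientMap_π.surjective u
    refine ((Set.finite_range fun g => c.ρ g x).subset fun y hy => ?_).isCompact
    exact (c.π_eq_iff x y).1 (Eq.symm hy)

namespace ChartFamily

variable {n : ℕ} {X : Type*} [TopologicalSpace X] {I : Type*}

/-- Two concrete embeddings with the same source and target whose images meet: the image of the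
second is contained in the image of the first. -/
theorem ConcreteEmbedding.range_subset {𝒰 : ChartFamily n X I} {i j : I}
    (a b : 𝒰.ConcreteEmbedding i j) {x y : 𝒰.dom i} (hxy : a.1 x = b.1 y) :
    Set.range b.1 ⊆ Set.range a.1 := by
  have := (𝒰.chart i).simplyConnected
  -- The part of `Ũ_j` over `U_i`. Into `T`, unlike into all of `Ũ_j`, the embedding `a` is proper:
  -- followed by the projection `p` to `U_i` it is `π_i`, and `T` is Hausdorff.
  let T : Set (𝒰.dom j) := {z | ((𝒰.chart j).π z : X) ∈ 𝒰.U i}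
  have hmem (c : 𝒰.ConcreteEmbedding i j) (z) : c.1 z ∈ T := by
    change ((𝒰.chart j).π (c.1 z) : X) ∈ 𝒰.U i
    rw [← c.2.2 z]
    exact Subtype.property _
  let a' : 𝒰.dom i → T := fun z => ⟨a.1 z, hmem a z⟩
  let b' : 𝒰.dom i → T := fun z => ⟨b.1 z, hmem b z⟩
  have ha' : Continuous a' := a.2.1.isEmbedding.continuous.subtype_mk _
  have hb' : Continuous b' := b.2.1.isEmbedding.continuous.subtype_mk _
  let p : T → 𝒰.U i := fun t => ⟨_, t.2⟩
  have hp : Continuous p := (continuous_subtype_val.comp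
    ((𝒰.chart j).isQuotientMap_π.continuous.comp continuous_subtype_val)).subtype_mk _
  have hpa : p ∘ a' = (𝒰.chart i).π := funext fun z => Subtype.ext (a.2.2 z).symm
  have hproper : IsProperMap a' :=
    isProperMap_of_comp_of_t2 ha' hp (hpa ▸ (𝒰.chart i).isProperMap_π)
  have hrange : Set.range a' = Subtype.val ⁻¹' Set.range a.1 := by
    ext t
    exact exists_congr fun _ => Subtype.ext_iff
  have hclopen : IsClopen (Set.range a') :=
    ⟨hproper.isClosedMap.isClosed_range,
      hrange ▸ a.2.1.isOpenMap.isOpen_range.preimage continuous_subtype_val⟩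
  -- A non-empty clopen subset of the connected space `Ũ_i`.
  have huniv : b' ⁻¹' Set.range a' = Set.univ :=
    (hclopen.preimage hb').eq_univ ⟨y, x, Subtype.ext hxy⟩
  rintro _ ⟨z, rfl⟩
  obtain ⟨w, hw⟩ : b' z ∈ Set.range a' := Set.eq_univ_iff_forall.1 huniv z
  exact ⟨w, congrArg Subtype.val hw⟩

/-- If the images of two concrete embeddings meet, one factors through the other. -/
theorem ConcreteEmbedding.exists_comp_eq {𝒰 : ChartFamily n X I} {i j : I}
    (a b : 𝒰.ConcreteEmbedding i j) {x y : 𝒰.dom i} (hxy : a.1 x = b.1 y) :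
    ∃ σ : 𝒰.ConcreteEmbedding i i, a.comp σ = b := by
  choose s hs using fun z => a.range_subset b hxy ⟨z, rfl⟩
  have hs' : a.1 ∘ s = b.1 := funext hs
  refine ⟨⟨s, a.2.1.of_comp (hs' ▸ b.2.1), fun z => ?_⟩, Subtype.ext hs'⟩
  exact (b.2.2 z).trans ((congrArg (fun w => ((𝒰.chart j).π w : X)) (hs z).symm).trans
    (a.2.2 (s z)).symm)

end ChartFamily

/-! ### Abstract embeddings and their underlying concrete embeddings. -/

namespace OrbifoldAtlas

open GroupBimodule ChartFamily

variable {n : ℕ} {X : Type*} [TopologicalSpace X] {I : Type*} (𝔘 : OrbifoldAtlas n X I)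

/-- The concrete embedding underlying an abstract embedding. -/
def tilde {i j : I} {hij : 𝔘.U i ≤ 𝔘.U j} (a : 𝔘.Abst.map hij) : 𝔘.ConcreteEmbedding i j :=
  𝔘.ρρ.tilde hij a

variable {𝔘}

theorem app_one_tmul {i j : I} {hij : 𝔘.U i ≤ 𝔘.U j} (a : 𝔘.Abst.map hij) :
    𝔘.ρρ.app hij (tmul (show ofHom (𝔘.ρ j) from (1 : 𝔘.Gred j)) a) =
      tmul (show 𝔘.Con.map hij from 𝔘.tilde a) (show ofHom (𝔘.ρ i) from (1 : 𝔘.Gred i)) :=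
  (𝔘.ρρ.tilde_unique hij a _).2 rfl

theorem tilde_smul {i j : I} {hij : 𝔘.U i ≤ 𝔘.U j} (g : 𝔘.G j) (a : 𝔘.Abst.map hij) :
    𝔘.tilde (g • a) = (ConcreteEmbedding.ofGred _ j (𝔘.ρ j g)).comp (𝔘.tilde a) := by
  symm
  refine (𝔘.ρρ.tilde_unique hij _ _).1 ?_
  have h1 : tmul (show ofHom (𝔘.ρ j) from (1 : 𝔘.Gred j)) (g • a) =
      𝔘.ρ j g • tmul (show ofHom (𝔘.ρ j) from (1 : 𝔘.Gred j)) a := by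
    refine (tmul_eq_tmul_iff (x' := a)).2 ⟨g, ?_, rfl⟩
    change 𝔘.ρ j g * 1 = 1 * 𝔘.ρ j g
    simp
  rw [h1, (𝔘.ρρ.app hij).map_left, app_one_tmul]
  rfl

theorem tilde_op_smul {i j : I} {hij : 𝔘.U i ≤ 𝔘.U j} (g : 𝔘.G i) (a : 𝔘.Abst.map hij) :
    𝔘.tilde (op g • a) = (𝔘.tilde a).comp (ConcreteEmbedding.ofGred _ i (𝔘.ρ i g)) := by
  symm
  refine (𝔘.ρρ.tilde_unique hij _ _).1 ?_
  have h1 : tmul (show ofHom (𝔘.ρ j) from (1 : 𝔘.Gred j)) (op g • a) =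
      op g • tmul (show ofHom (𝔘.ρ j) from (1 : 𝔘.Gred j)) a := rfl
  rw [h1, (𝔘.ρρ.app hij).map_right, app_one_tmul]
  refine (tmul_eq_tmul_iff (y := show 𝔘.Con.map hij from 𝔘.tilde a)).2 ⟨𝔘.ρ i g, rfl, ?_⟩
  change 1 * 𝔘.ρ i g = 𝔘.ρ i g * 1
  simp

theorem tilde_comp {i j k : I} {hij : 𝔘.U i ≤ 𝔘.U j} {hjk : 𝔘.U j ≤ 𝔘.U k}
    (b : 𝔘.Abst.map hjk) (a : 𝔘.Abst.map hij) :
    𝔘.tilde (𝔘.comp b a) = (𝔘.tilde b).comp (𝔘.tilde a) := by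
  symm
  exact (𝔘.ρρ.tilde_unique _ _ _).1
    (𝔘.ρρ.app_comp hij hjk _ b a _ _ _ _ (app_one_tmul b) (app_one_tmul a))

/-- Every concrete embedding of a chart into itself is given by an element of the group. -/
theorem exists_ofGred_eq {i : I} (σ : 𝔘.ConcreteEmbedding i i) :
    ∃ g : 𝔘.G i, ConcreteEmbedding.ofGred _ i (𝔘.ρ i g) = σ := by
  -- A preimage of `σ ⊗ 1` has the form `r ⊗ unit g`, since the unit cell is surjective. The unit
  -- law then gives `σ = r * ρ g`, and `r` is itself `ρ k`.
  obtain ⟨t, ht⟩ := 𝔘.surjective (le_refl (𝔘.U i))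
    (tmul (show 𝔘.Con.map le_rfl from σ) (show ofHom (𝔘.ρ i) from (1 : 𝔘.Gred i)))
  obtain ⟨r, a, rfl⟩ := exists_tmul t
  obtain ⟨(g : 𝔘.G i), rfl⟩ := (𝔘.isPseudofunctor.unit_bijective i).2 a
  have h := (𝔘.ρρ.app_unit i r g).symm.trans ht
  have h' := congrArg (contract (𝔘.ρ i) (𝔘.Con.map le_rfl)) h
  rw [contract_tmul, contract_tmul, op_one, one_smul, one_smul] at h'
  obtain ⟨k, hk⟩ := (𝔘.chart i).ρ.rangeRestrict_surjective (show 𝔘.Gred i from r)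
  refine ⟨k * g, ?_⟩
  rw [map_mul]
  exact (congrArg (fun s => ConcreteEmbedding.ofGred _ i (s * 𝔘.ρ i g)) hk).trans h'

/-- If the image of an abstract embedding `a` meets its translate by `g`, then `g • a = a • h` for
some element `h` of the group of the source. -/
theorem exists_op_smul_eq_smul {i j : I} {hij : 𝔘.U i ≤ 𝔘.U j} (a : 𝔘.Abst.map hij) (g : 𝔘.G j)
    {x y : 𝔘.dom i} (hxy : (𝔘.tilde a).1 x = (𝔘.tilde (g • a)).1 y) :
    ∃ h : 𝔘.G i, op h • a = g • a := by
  obtain ⟨σ, hσ⟩ := (𝔘.tilde a).exists_comp_eq _ hxy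
  obtain ⟨h, rfl⟩ := exists_ofGred_eq σ
  rw [← tilde_op_smul] at hσ
  -- Equal concrete embeddings determine the abstract ones only up to the right action; the
  -- discrepancy `k` is absorbed into `h`.
  obtain ⟨k, hk⟩ := 𝔘.transitive_on_kernel hij (op h • a) (g • a) (by
    rw [app_one_tmul, app_one_tmul, hσ])
  exact ⟨h * k, by rw [op_mul, mul_smul, hk]⟩

theorem comp_op_smul {i j k : I} {hij : 𝔘.U i ≤ 𝔘.U j} {hjk : 𝔘.U j ≤ 𝔘.U k} (h : 𝔘.G j)
    (b : 𝔘.Abst.map hjk) (a : 𝔘.Abst.map hij) : 𝔘.comp (op h • b) a = 𝔘.comp b (h • a) :=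
  congrArg (𝔘.Abst.comp hij hjk) (tmul_eq_tmul_iff.2 ⟨h, rfl, rfl⟩).symm

theorem smul_comp {i j k : I} {hij : 𝔘.U i ≤ 𝔘.U j} {hjk : 𝔘.U j ≤ 𝔘.U k} (g : 𝔘.G k)
    (b : 𝔘.Abst.map hjk) (a : 𝔘.Abst.map hij) : 𝔘.comp (g • b) a = g • 𝔘.comp b a :=
  (𝔘.Abst.comp hij hjk).map_left g (tmul b a)

/-- An abstract embedding can be chosen so as to take a given point to a given point over the same
point of the space. -/
theorem exists_tilde_apply_eq {i j : I} (hij : 𝔘.U i ≤ 𝔘.U j) (y : 𝔘.dom i) (x : 𝔘.dom j)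
    (h : ((𝔘.chart i).π y : X) = (𝔘.chart j).π x) :
    ∃ a : 𝔘.Abst.map hij, (𝔘.tilde a).1 y = x := by
  obtain ⟨a⟩ := (𝔘.isAtlasBimodule hij).nonempty
  obtain ⟨g, hg⟩ := ((𝔘.chart j).π_eq_iff ((𝔘.tilde a).1 y) x).1
    (Subtype.ext (((𝔘.tilde a).2.2 y).symm.trans h))
  exact ⟨g • a, by rw [tilde_smul]; exact hg⟩

end OrbifoldAtlas

/-! ### The common refinement. -/

theorem mainTheorem7 {n : ℕ} {X : Type*} [TopologicalSpace X] [ParacompactSpace X]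
    [SecondCountableTopology X] [T2Space X] {I : Type*} (𝔘 : OrbifoldAtlas n X I)
    (i₁ i₂ i₃ : I) (h₃₁ : 𝔘.U i₁ ≤ 𝔘.U i₃) (h₃₂ : 𝔘.U i₂ ≤ 𝔘.U i₃)
    (x₁ : 𝔘.dom i₁) (x₂ : 𝔘.dom i₂) (x₃ : 𝔘.dom i₃)
    (lam₃₁ : 𝔘.Abst.map h₃₁) (lam₃₂ : 𝔘.Abst.map h₃₂)
    (hx₁ : 𝔘.concrete lam₃₁ x₁ = x₃) (hx₂ : 𝔘.concrete lam₃₂ x₂ = x₃) :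
    ∃ (i₄ : I) (h₁₄ : 𝔘.U i₄ ≤ 𝔘.U i₁) (h₂₄ : 𝔘.U i₄ ≤ 𝔘.U i₂) (y : 𝔘.dom i₄)
      (kap₁₄ : 𝔘.Abst.map h₁₄) (kap₂₄ : 𝔘.Abst.map h₂₄),
      𝔘.concrete kap₁₄ y = x₁ ∧ 𝔘.concrete kap₂₄ y = x₂ ∧
        𝔘.comp lam₃₁ kap₁₄ = 𝔘.comp lam₃₂ kap₂₄ := by
  have hπ {i j : I} {hij : 𝔘.U i ≤ 𝔘.U j} {a : 𝔘.Abst.map hij} {x : 𝔘.dom i} {z : 𝔘.dom j}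
      (h : 𝔘.concrete a x = z) : ((𝔘.chart i).π x : X) = (𝔘.chart j).π z :=
    h ▸ (𝔘.tilde a).2.2 x
  have hx : ((𝔘.chart i₁).π x₁ : X) = (𝔘.chart i₂).π x₂ := (hπ hx₁).trans (hπ hx₂).symm
  -- The concrete embeddings provided here are not needed: atlas bimodules are non-empty, so the
  -- inclusions already yield abstract ones.
  obtain ⟨i₄, hmem, h₁₄, h₂₄, -⟩ := 𝔘.isSatakeAtlas.locally_compatible i₁ i₂
    ((𝔘.chart i₁).π x₁) (Subtype.property _) (hx ▸ Subtype.property _)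
  obtain ⟨y, hy⟩ := (𝔘.chart i₄).isQuotientMap_π.surjective ⟨_, hmem⟩
  have hy₁ : ((𝔘.chart i₄).π y : X) = (𝔘.chart i₁).π x₁ := congrArg Subtype.val hy
  obtain ⟨a, ha⟩ := OrbifoldAtlas.exists_tilde_apply_eq h₁₄ y x₁ hy₁
  obtain ⟨b, hb⟩ := OrbifoldAtlas.exists_tilde_apply_eq h₂₄ y x₂ (hy₁.trans hx)
  obtain ⟨g, hg⟩ := (𝔘.isAtlasBimodule (h₁₄.trans h₃₁)).left_transitive
    (𝔘.comp lam₃₁ a) (𝔘.comp lam₃₂ b)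
  rw [← OrbifoldAtlas.smul_comp] at hg
  -- Both sides of `hg`, evaluated at `y`.
  have hfix : (𝔘.tilde (g • lam₃₁)).1 x₁ = x₃ := by
    have h := congrArg (fun c => (𝔘.tilde c).1 y) hg
    simp only [OrbifoldAtlas.tilde_comp] at h
    rw [← ha, ← hx₂, ← hb]
    exact h
  obtain ⟨h, hh⟩ := OrbifoldAtlas.exists_op_smul_eq_smul lam₃₁ g (x := x₁) (y := x₁)
    (hx₁.trans hfix.symm)
  -- The concrete map of `lam₃₁` is injective and sends both `x₁` and its translate by `h` to `x₃`.
  -- Hence replacing `a` by `h • a` still takes `y` to `x₁`.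
  have hfix₁ : (ChartFamily.ConcreteEmbedding.ofGred 𝔘.toChartFamily i₁ (𝔘.ρ i₁ h)).1 x₁ = x₁ := by
    apply (𝔘.tilde lam₃₁).2.1.isEmbedding.injective
    rw [← hh, OrbifoldAtlas.tilde_op_smul] at hfix
    exact hfix.trans hx₁.symm
  refine ⟨i₄, h₁₄, h₂₄, y, h • a, b, ?_, hb, ?_⟩
  · change (𝔘.tilde (h • a)).1 y = x₁
    rw [OrbifoldAtlas.tilde_smul]
    exact (congrArg _ ha).trans hfix₁
  -- `lam₃₁ ⊗ (h • a) = (lam₃₁ · h) ⊗ a = (g • lam₃₁) ⊗ a`, whose composite is that of `lam₃₂ ⊗ b`.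
  · rw [← OrbifoldAtlas.comp_op_smul, hh, hg]
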